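/- Let $A\subset\mathbb C[z]$ be a unital subalgebra, let $\mathfrak c=\{f\in A: f\,\mathbb C[z]\subset A\}$ be its conductor (an ideal of $\mathbb C[z]$), and assume that all points of the support of $\mathfrak c$ (the common zeros in $\mathbb C$ of the elements of $\mathfrak c$) lie in the open unit disc $\mathbb D$; in particular $\mathfrak c\neq 0$. Regard $H^2$ and $H^\infty$ as spaces of boundary functions on the unit circle $\mathbb T$, and let $\mathfrak A\subset H^\infty$ be the weak-$*$ closure of $A$. Put $\mathcal C=\overline{\mathfrak c H^2}$ (closed linear span in $H^2$). Then $\mathcal C=B_{\mathfrak c}H^2$, where $B_{\mathfrak c}(z)=\prod_j\bigl(\frac{z-\alpha_j}{1-\overline{\alpha_j}z}\bigr)^{m_j}$ if $\prod_j(z-\alpha_j)^{m_j}$ is the monic generator of $\mathfrak c$. For an $A/\mathfrak c$-submodule $M\subset\mathbb C[z]/\mathfrak c$ set $H^2_M=M\oplus\mathcal C=M\oplus B_{\mathfrak c}H^2$, where $M$ is viewed in $H^2\ominus\mathcal C$ through the map $\mathbb C[z]/\mathfrak c\to H^2\ominus\mathcal C$, $p+\mathfrak c\mapsto P_{\mathcal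 C^\perp}p$. (Generalized Helson–Lowdenslager theorem.) Let $\mathcal N\subset L^2(\mathbb T)$ be a closed $\mathfrak A$-invariant subspace that is not $H^\infty$-invariant. Then there exist an $A/\mathfrak c$-submodule $M\subset\mathbb C[z]/\mathfrak c$ and a unimodular measurable function $J$ on $\mathbb T$ (that is, $|J|=1$ almost everywhere) such that $\mathcal N=J\,H^2_M$. -/

import Mathlib

open MeasureTheory Polynomial
open scoped ENNReal Topology ComplexConjugate

namespace HelsonLowdenslager

/-- Normalized Lebesgue (Haar) measure on the unit circle `𝕋`, which is parametrized by
`ℝ / ℤ` through `t ↦ exp (2 π i t)`. -/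
noncomputable abbrev circleMeasure : Measure UnitAddCircle := AddCircle.haarAddCircle

/-- The space `L^p(𝕋)`. -/
noncomputable abbrev LpT (p : ℝ≥0∞) := Lp ℂ p circleMeasure

/-- The product `a f ∈ L²(𝕋)` of `a ∈ L^∞(𝕋)` and `f ∈ L²(𝕋)`. -/
noncomputable def mulL2 (a : LpT ∞) (f : LpT 2) : LpT 2 := a • f

theorem integrable_LpT {p : ℝ≥0∞} [hp : Fact (1 ≤ p)] (f : LpT p) :
    Integrable (f : UnitAddCircle → ℂ) circleMeasure :=
  (Lp.memLp f).integrable hp.out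

/-- The Hardy space `H^p(𝕋)`, realized by boundary values: the functions in `L^p(𝕋)` whose
Fourier coefficients of negative index vanish. `Hardy 2` is `H²` and `Hardy ∞` is `H^∞`. -/
noncomputable def Hardy (p : ℝ≥0∞) [Fact (1 ≤ p)] : Submodule ℂ (LpT p) where
  carrier := {f | ∀ n : ℤ, n < 0 → fourierCoeff (f : UnitAddCircle → ℂ) n = 0}
  zero_mem' n _ := by
    rw [fourierCoeff_congr_ae (Lp.coeFn_zero ℂ p circleMeasure)]
    simp [fourierCoeff]
  add_mem' {f g} hf hg n hn := by
    rw [fourierCoeff_congr_ae (Lp.coeFn_add f g),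
      fourierCoeff.add (integrable_LpT f) (integrable_LpT g), Pi.add_apply, hf n hn, hg n hn,
      add_zero]
  smul_mem' c f hf n hn := by
    rw [fourierCoeff_congr_ae (Lp.coeFn_smul c f), fourierCoeff.const_smul, hf n hn, smul_zero]

/-- The restriction of a polynomial in `z` to the unit circle, as a continuous function;
`fourier 1` is the coordinate function `z = exp (2 π i t)`. -/
noncomputable def polyCircle : ℂ[X] →ₐ[ℂ] C(UnitAddCircle, ℂ) := Polynomial.aeval (fourier 1)

/-- A polynomial as an element of `L^∞(𝕋)`. -/
noncomputable def polyLinfty (f : ℂ[X]) : LpT ∞ :=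
  ContinuousMap.toLp ∞ circleMeasure ℂ (polyCircle f)

/-- The linear map that sends a polynomial to its class in `L²(𝕋)`. -/
noncomputable def polyL2 : ℂ[X] →ₗ[ℂ] LpT 2 :=
  (ContinuousMap.toLp (E := ℂ) 2 circleMeasure ℂ).toLinearMap ∘ₗ polyCircle.toLinearMap

/-- The weak-* topology of `L^∞(𝕋) = L¹(𝕋)*`: the coarsest topology for which all the functionals
`f ↦ ∫ f g` with `g ∈ L¹(𝕋)` are continuous. -/
@[reducible] noncomputable def weakStar : TopologicalSpace (LpT ∞) :=
  TopologicalSpace.induced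
    (fun (f : LpT ∞) (g : LpT 1) => ∫ t, f t * g t ∂circleMeasure) Pi.topologicalSpace

/-- The weak-* closure `𝔄` of an algebra `A` of polynomials (`H^∞` is weak-* closed in `L^∞`,
so this is also the closure within `H^∞`). -/
noncomputable def weakStarClosure (A : Subalgebra ℂ ℂ[X]) : Set (LpT ∞) :=
  closure[weakStar] (polyLinfty '' (A : Set ℂ[X]))

/-- The conductor `𝔠 = {f ∈ A : f ℂ[z] ⊆ A}` of `A` in `ℂ[z]`, an ideal of `ℂ[z]`. -/
def conductorIdeal (A : Subalgebra ℂ ℂ[X]) : Ideal ℂ[X] where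
  carrier := {f | f ∈ A ∧ ∀ g : ℂ[X], f * g ∈ A}
  zero_mem' := ⟨A.zero_mem, fun g => by rw [zero_mul]; exact A.zero_mem⟩
  add_mem' ha hb :=
    ⟨A.add_mem ha.1 hb.1, fun g => by rw [add_mul]; exact A.add_mem (ha.2 g) (hb.2 g)⟩
  smul_mem' c a ha :=
    ⟨by rw [smul_eq_mul, mul_comm]; exact ha.2 c,
      fun g => by rw [smul_eq_mul, mul_comm c a, mul_assoc]; exact ha.2 (c * g)⟩

/-- The ring `A / 𝔠`, as a subalgebra of `ℂ[z] / 𝔠`. -/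
noncomputable abbrev quotAlg (A : Subalgebra ℂ ℂ[X]) : Subalgebra ℂ (ℂ[X] ⧸ conductorIdeal A) :=
  A.map (Ideal.Quotient.mkₐ ℂ (conductorIdeal A))

/-- The closed subspace `𝒞` of `H²` generated by the products `f h`, `f ∈ 𝔠`, `h ∈ H²`. -/
noncomputable def conductorSpace (A : Subalgebra ℂ ℂ[X]) : Submodule ℂ (LpT 2) :=
  (Submodule.span ℂ
    {u | ∃ f ∈ conductorIdeal A, ∃ h ∈ Hardy 2, u = mulL2 (polyLinfty f) h}).topologicalClosure

/-- The copy of `M ⊆ ℂ[z] / 𝔠` in `H² ⊖ 𝒞`: the class of a polynomial `p` corresponds to the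
orthogonal projection of `p` to `𝒞ᗮ`. -/
noncomputable def complementPart (A : Subalgebra ℂ ℂ[X])
    (M : Submodule (quotAlg A) (ℂ[X] ⧸ conductorIdeal A)) : Submodule ℂ (LpT 2) :=
  ((M.restrictScalars ℂ).comap (Ideal.Quotient.mkₐ ℂ (conductorIdeal A)).toLinearMap).map
    ((conductorSpace A)ᗮ.starProjection.toLinearMap ∘ₗ polyL2)

/-- The space `H²_M = M ⊕ 𝒞` (an orthogonal sum). -/
noncomputable def H2sub (A : Subalgebra ℂ ℂ[X])
    (M : Submodule (quotAlg A) (ℂ[X] ⧸ conductorIdeal A)) : Submodule ℂ (LpT 2) :=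
  complementPart A M ⊔ conductorSpace A

/-- The boundary values of the finite Blaschke product whose zeros, with multiplicity, are the
zeros of a generator of `𝔠`. -/
noncomputable def blaschke (A : Subalgebra ℂ ℂ[X]) (t : UnitAddCircle) : ℂ :=
  ((Submodule.IsPrincipal.generator (conductorIdeal A)).roots.map
    fun α => (fourier 1 t - α) / (1 - conj α * fourier 1 t)).prod

end HelsonLowdenslager

open HelsonLowdenslager

/-!
Let `W` be the closed shift-invariant subspace generated by `𝒩`, so that `𝔠 W ⊆ 𝒩 ⊆ W`. By the
classical Helson–Lowdenslager theorem `W` is `L^∞`-invariant or `W = J H²` with `J` unimodular. In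
the first case a vector of `W` orthogonal to `𝒩` is annihilated by the conjugate of a nonzero
polynomial, so `𝒩 = W` is `L^∞`-invariant. In the second case `𝒞 ⊆ J⁻¹ 𝒩 ⊆ H²`, and since
`H² = ℂ[z] + 𝒞`, the space `J⁻¹ 𝒩` is determined by the polynomials it contains.

The identity `𝒞 = B H²` holds because a generator of `𝔠` is `B E` with a polynomial `E` whose zeros
lie outside the closed disc: by spectral mapping `E` is invertible on `H²`, where the shift is a
contraction.
-/

namespace HelsonLowdenslager

open Filter Function

section FourierUniqueness

theorem ae_eq_zero_of_forall_integral_continuous_smul_eq_zero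
    {X E : Type*} [TopologicalSpace X] [HasOuterApproxClosed X] [MeasurableSpace X] [BorelSpace X]
    {μ : Measure X} [NormedAddCommGroup E] [NormedSpace ℂ E] [CompleteSpace E] {f : X → E}
    (hf : Integrable f μ) (h : ∀ φ : C(X, ℂ), ∫ x, φ x • f x ∂μ = 0) : f =ᵐ[μ] 0 := by
  refine ae_eq_zero_of_forall_setIntegral_isClosed_eq_zero hf fun s hs => ?_
  let φ (n : ℕ) : C(X, ℂ) := ⟨fun x => ((hs.apprSeq n x : ℝ) : ℂ), by fun_prop⟩
  have hφ_le (n : ℕ) (x : X) : ‖φ n x • f x‖ ≤ ‖f x‖ := by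
    rw [norm_smul]
    refine mul_le_of_le_one_left (norm_nonneg _) ?_
    simpa [φ] using HasOuterApproxClosed.apprSeq_apply_le_one hs n x
  have hφ_tendsto (x : X) :
      Tendsto (fun n => φ n x • f x) atTop (𝓝 (s.indicator f x)) := by
    have hx := tendsto_pi_nhds.1 (HasOuterApproxClosed.tendsto_apprSeq hs) x
    have hc : Continuous fun r : NNReal => ((r : ℝ) : ℂ) • f x := by fun_prop
    have hind : s.indicator f x = (((s.indicator (fun _ => 1) x : NNReal) : ℝ) : ℂ) • f x := by
      by_cases hxs : x ∈ s <;> simp [hxs]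
    exact hind ▸ (hc.tendsto _).comp hx
  have hlim : Tendsto (fun n => ∫ x, φ n x • f x ∂μ) atTop (𝓝 (∫ x, s.indicator f x ∂μ)) :=
    tendsto_integral_of_dominated_convergence (fun x => ‖f x‖)
      (fun n => (φ n).continuous.aestronglyMeasurable.smul hf.1) hf.norm
      (fun n => ae_of_all _ (hφ_le n)) (ae_of_all _ hφ_tendsto)
  rw [← integral_indicator hs.measurableSet]
  exact tendsto_nhds_unique hlim (tendsto_const_nhds.congr fun n => (h (φ n)).symm)

variable {T : ℝ} [Fact (0 < T)] {E : Type*} [NormedAddCommGroup E] [NormedSpace ℂ E]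
  [CompleteSpace E] {f g : AddCircle T → E}

theorem ae_eq_zero_of_fourierCoeff_eq_zero (hf : Integrable f AddCircle.haarAddCircle)
    (h : ∀ n, fourierCoeff f n = 0) : f =ᵐ[AddCircle.haarAddCircle] 0 := by
  refine ae_eq_zero_of_forall_integral_continuous_smul_eq_zero hf fun φ => ?_
  let L : C(AddCircle T, ℂ) →L[ℂ] E :=
    ((ContinuousLinearMap.lsmul ℂ ℂ).lpPairing AddCircle.haarAddCircle ∞ 1).flip hf.toL1 ∘L
      ContinuousMap.toLp ∞ AddCircle.haarAddCircle ℂ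
  have hL (ψ : C(AddCircle T, ℂ)) : L ψ = ∫ t, ψ t • f t ∂AddCircle.haarAddCircle := by
    refine (ContinuousLinearMap.lpPairing_eq_integral _ _ _).trans (integral_congr_ae ?_)
    filter_upwards [ContinuousMap.coeFn_toLp (p := ∞) (𝕜 := ℂ) AddCircle.haarAddCircle ψ,
      hf.coeFn_toL1] with t hψ hft
    exact congrArg₂ (· • ·) hψ hft
  have hker : Submodule.span ℂ (Set.range (fourier (T := T))) ≤ L.ker := by
    rw [Submodule.span_le]
    rintro _ ⟨n, rfl⟩
    have hn := h (-n)
    rwa [fourierCoeff, neg_neg, ← hL] at hn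
  have htop := Submodule.topologicalClosure_minimal _ hker L.isClosed_ker
  rw [span_fourier_closure_eq_top] at htop
  rw [← hL]
  exact htop (Submodule.mem_top : φ ∈ ⊤)

theorem ae_eq_of_fourierCoeff_eq (hf : Integrable f AddCircle.haarAddCircle)
    (hg : Integrable g AddCircle.haarAddCircle) (h : ∀ n, fourierCoeff f n = fourierCoeff g n) :
    f =ᵐ[AddCircle.haarAddCircle] g := by
  refine (ae_eq_zero_of_fourierCoeff_eq_zero (hf.sub hg) fun n => ?_).mono fun t => sub_eq_zero.1
  rw [sub_eq_add_neg, fourierCoeff.add hf hg.neg, ← neg_one_smul ℂ g, Pi.add_apply,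
    fourierCoeff.const_smul, h, neg_one_smul, add_neg_cancel]

end FourierUniqueness

section Multiplication

variable {X : Type*} [MeasurableSpace X]

/-- The action of `L^∞(μ)` on `L^p(μ)` by pointwise multiplication, as a bounded bilinear map. -/
noncomputable def mulLp (μ : Measure X) (p : ℝ≥0∞) [Fact (1 ≤ p)] :
    Lp ℂ ∞ μ →L[ℂ] Lp ℂ p μ →L[ℂ] Lp ℂ p μ :=
  (ContinuousLinearMap.mul ℂ ℂ).holderL μ ∞ p p

variable {μ : Measure X} {p : ℝ≥0∞} [Fact (1 ≤ p)]

theorem coeFn_mulLp (a : Lp ℂ ∞ μ) (f : Lp ℂ p μ) :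
    (mulLp μ p a f : X → ℂ) =ᵐ[μ] fun x => a x * f x :=
  ContinuousLinearMap.coeFn_holder _ _ _

theorem mulLp_comm (a b : Lp ℂ ∞ μ) (f : Lp ℂ p μ) :
    mulLp μ p a (mulLp μ p b f) = mulLp μ p b (mulLp μ p a f) := by
  apply Lp.ext
  filter_upwards [coeFn_mulLp a f, coeFn_mulLp b f, coeFn_mulLp a (mulLp μ p b f),
    coeFn_mulLp b (mulLp μ p a f)] with x ha hb hab hba
  rw [hab, hba, ha, hb, mul_left_comm]

theorem mulLp_star_mulLp {J : Lp ℂ ∞ μ} (hJ : ∀ᵐ x ∂μ, ‖J x‖ = 1) (f : Lp ℂ p μ) :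
    mulLp μ p (star J) (mulLp μ p J f) = f := by
  apply Lp.ext
  filter_upwards [hJ, Lp.coeFn_star J, coeFn_mulLp J f, coeFn_mulLp (star J) (mulLp μ p J f)]
    with x hx hs h₁ h₂
  rw [h₂, h₁, hs, ← mul_assoc, Pi.star_apply, RCLike.star_def, RCLike.conj_mul, hx]
  simp

theorem mulLp_bijective {J : Lp ℂ ∞ μ} (hJ : ∀ᵐ x ∂μ, ‖J x‖ = 1) :
    Bijective (mulLp μ p J) :=
  ⟨LeftInverse.injective (mulLp_star_mulLp hJ),
    fun f => ⟨mulLp μ p (star J) f, by rw [mulLp_comm, mulLp_star_mulLp hJ]⟩⟩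

theorem inner_mulLp_left (a : Lp ℂ ∞ μ) (f g : Lp ℂ 2 μ) :
    inner ℂ (mulLp μ 2 a f) g = inner ℂ f (mulLp μ 2 (star a) g) := by
  rw [L2.inner_def, L2.inner_def]
  refine integral_congr_ae ?_
  filter_upwards [Lp.coeFn_star a, coeFn_mulLp a f, coeFn_mulLp (star a) g] with x hs hf hg
  simp only [RCLike.inner_apply', hf, hg, hs, Pi.star_apply, RCLike.star_def, map_mul]
  ring

theorem integrable_conj_mul (f g : Lp ℂ 2 μ) : Integrable (fun x => conj (f x) * g x) μ := by
  simpa only [RCLike.inner_apply'] using L2.integrable_inner (𝕜 := ℂ) f g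

variable [TopologicalSpace X] [CompactSpace X] [BorelSpace X] [IsFiniteMeasure μ]

theorem coeFn_mulLp_toLp (φ : C(X, ℂ)) (f : Lp ℂ p μ) :
    (mulLp μ p (ContinuousMap.toLp ∞ μ ℂ φ) f : X → ℂ) =ᵐ[μ] fun x => φ x * f x := by
  filter_upwards [coeFn_mulLp (ContinuousMap.toLp ∞ μ ℂ φ) f,
    ContinuousMap.coeFn_toLp (p := ∞) (𝕜 := ℂ) μ φ] with x h hφ
  rw [h, hφ]

/-- The representation of the algebra of continuous functions on `L^p(μ)` by multiplication. -/
noncomputable def mulCont (μ : Measure X) [IsFiniteMeasure μ] (p : ℝ≥0∞) [Fact (1 ≤ p)] :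
    C(X, ℂ) →ₐ[ℂ] (Lp ℂ p μ →L[ℂ] Lp ℂ p μ) :=
  AlgHom.ofLinearMap (mulLp μ p ∘L ContinuousMap.toLp ∞ μ ℂ).toLinearMap
    (by
      ext1 f
      apply Lp.ext
      filter_upwards [coeFn_mulLp_toLp 1 f] with x h
      exact h.trans (one_mul _))
    (fun φ ψ => by
      ext1 f
      apply Lp.ext
      filter_upwards [coeFn_mulLp_toLp (φ * ψ) f, coeFn_mulLp_toLp ψ f,
        coeFn_mulLp_toLp φ (mulLp μ p (ContinuousMap.toLp ∞ μ ℂ ψ) f)] with x hφψ hψ hφ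
      exact hφψ.trans (((mul_assoc _ _ _).trans (congrArg _ hψ.symm)).trans hφ.symm))

theorem coeFn_mulCont (φ : C(X, ℂ)) (f : Lp ℂ p μ) :
    (mulCont μ p φ f : X → ℂ) =ᵐ[μ] fun x => φ x * f x :=
  coeFn_mulLp_toLp φ f

theorem mulLp_mulCont_comm (a : Lp ℂ ∞ μ) (φ : C(X, ℂ)) (f : Lp ℂ p μ) :
    mulLp μ p a (mulCont μ p φ f) = mulCont μ p φ (mulLp μ p a f) :=
  mulLp_comm _ _ _

theorem norm_mulCont_le (φ : C(X, ℂ)) : ‖mulCont μ p φ‖ ≤ ‖φ‖ := by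
  refine ContinuousLinearMap.opNorm_le_bound _ (norm_nonneg _) fun f => ?_
  refine Lp.norm_le_mul_norm_of_ae_le_mul ?_
  filter_upwards [coeFn_mulCont φ f] with x h
  rw [h, norm_mul]
  exact mul_le_mul_of_nonneg_right (φ.norm_coe_le_norm x) (norm_nonneg _)

theorem isUnit_mulCont {φ : C(X, ℂ)} (hφ : ∀ x, φ x ≠ 0) : IsUnit (mulCont μ p φ) :=
  ((ContinuousMap.isUnit_iff_forall_ne_zero φ).2 hφ).map (mulCont μ p)

end Multiplication

section Operators

variable {E : Type*} [NormedAddCommGroup E]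

theorem isClosed_map_of_isUnit [NormedSpace ℂ E] {T : E →L[ℂ] E} (hT : IsUnit T)
    {S : Submodule ℂ E} (hS : IsClosed (S : Set E)) : IsClosed (S.map T.toLinearMap : Set E) := by
  obtain ⟨u, rfl⟩ := hT
  exact (ContinuousLinearEquiv.ofUnit u).toHomeomorph.isClosedMap _ hS

theorem coe_aeval_restrict_apply [NormedSpace ℂ E] {T : E →L[ℂ] E} {W : Submodule ℂ E}
    (hT : ∀ f ∈ W, T f ∈ W) (p : ℂ[X]) (f : W) :
    (aeval (T.restrict hT) p f : E) = aeval T p f := by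
  induction p using Polynomial.induction_on generalizing f with
  | C c => simp [Algebra.algebraMap_eq_smul_one]
  | add p q hp hq => simp [hp, hq]
  | monomial n c ih =>
    rw [pow_succ, ← mul_assoc, map_mul _ (C c * X ^ n), map_mul _ (C c * X ^ n), aeval_X, aeval_X,
      mul_apply_eq_comp, mul_apply_eq_comp, ih, ContinuousLinearMap.coe_restrict_apply]

theorem aeval_apply_mem [NormedSpace ℂ E] {T : E →L[ℂ] E} {W : Submodule ℂ E}
    (hT : ∀ f ∈ W, T f ∈ W) (p : ℂ[X]) {f : E} (hf : f ∈ W) : aeval T p f ∈ W :=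
  coe_aeval_restrict_apply hT p ⟨f, hf⟩ ▸ (aeval (T.restrict hT) p ⟨f, hf⟩).2

theorem isUnit_aeval_of_norm_le_one [NormedSpace ℂ E] [CompleteSpace E] {T : E →L[ℂ] E}
    (hT : ‖T‖ ≤ 1) {p : ℂ[X]} (hp : ∀ α, p.IsRoot α → 1 < ‖α‖) : IsUnit (aeval T p) := by
  cases subsingleton_or_nontrivial E
  · exact isUnit_of_subsingleton _
  rw [← spectrum.zero_notMem_iff ℂ,
    spectrum.map_polynomial_aeval_of_nonempty _ _ (spectrum.nonempty T)]
  rintro ⟨α, hα, hαp⟩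
  exact (hp α hαp).not_ge ((spectrum.norm_le_norm_of_mem hα).trans hT)

theorem exists_mem_orthogonal_ne_zero_of_lt [InnerProductSpace ℂ E] {K L : Submodule ℂ E}
    [K.HasOrthogonalProjection] (h : K < L) : ∃ v ∈ L, v ∈ Kᗮ ∧ v ≠ 0 := by
  have hne : Kᗮ ⊓ L ≠ ⊥ := fun hbot => h.ne <| by
    rw [← Submodule.sup_orthogonal_inf_of_hasOrthogonalProjection h.le, hbot, sup_bot_eq]
  obtain ⟨v, ⟨hvK, hvL⟩, hv⟩ := Submodule.exists_mem_ne_zero_of_ne_bot hne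
  exact ⟨v, hvL, hvK, hv⟩

theorem map_starProjection_orthogonal_sup [InnerProductSpace ℂ E] (K S : Submodule ℂ E)
    [S.HasOrthogonalProjection] :
    K.map Sᗮ.starProjection.toLinearMap ⊔ S = K ⊔ S := by
  have hsub (f : E) : f - Sᗮ.starProjection f ∈ S := by
    rw [Submodule.starProjection_orthogonal_val, sub_sub_cancel]
    exact Submodule.starProjection_apply_mem _ _
  refine le_antisymm (sup_le ?_ le_sup_right) (sup_le (fun f hf => ?_) le_sup_right)
  · rintro _ ⟨f, hf, rfl⟩
    rw [← sub_sub_cancel f (Sᗮ.starProjection.toLinearMap f)]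
    exact sub_mem (Submodule.mem_sup_left hf) (Submodule.mem_sup_right (hsub f))
  · rw [← add_sub_cancel (Sᗮ.starProjection f) f]
    exact Submodule.add_mem_sup (Submodule.mem_map_of_mem hf) (hsub f)

end Operators

theorem eq_of_mulLp_mem {X : Type*} [MeasurableSpace X] {μ : Measure X}
    {N W : Submodule ℂ (Lp ℂ 2 μ)} (hN : IsClosed (N : Set (Lp ℂ 2 μ))) (hNW : N ≤ W)
    (hW : ∀ b : Lp ℂ ∞ μ, ∀ f ∈ W, mulLp μ 2 b f ∈ W) {a : Lp ℂ ∞ μ} (ha : ∀ᵐ x ∂μ, a x ≠ 0)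
    (haW : ∀ f ∈ W, mulLp μ 2 a f ∈ N) : N = W := by
  have : CompleteSpace N := hN.completeSpace_coe
  refine hNW.eq_of_not_lt fun hlt => ?_
  obtain ⟨v, hvW, hvN, hv⟩ := exists_mem_orthogonal_ne_zero_of_lt hlt
  have hav : mulLp μ 2 (star a) v = 0 := by
    rw [← inner_self_eq_zero (𝕜 := ℂ), inner_mulLp_left, star_star]
    exact Submodule.inner_left_of_mem_orthogonal (haW _ (hW _ v hvW)) hvN
  refine hv (Lp.ext ?_)
  filter_upwards [ha, Lp.coeFn_star a, coeFn_mulLp (star a) v, Lp.coeFn_zero ℂ 2 μ]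
    with x hx hs h h0
  rw [hav, h0, hs] at h
  rw [h0]
  simpa [hx] using h.symm

section Laurent

/-- The Laurent operator on `L²(𝕋)` with a continuous symbol. -/
noncomputable abbrev laurent : C(UnitAddCircle, ℂ) →ₐ[ℂ] (LpT 2 →L[ℂ] LpT 2) :=
  mulCont circleMeasure 2

/-- The bilateral shift on `L²(𝕋)`: multiplication by the coordinate function `z`. -/
noncomputable abbrev shift : LpT 2 →L[ℂ] LpT 2 := laurent (fourier 1)

theorem aeval_shift (p : ℂ[X]) : aeval shift p = laurent (polyCircle p) :=
  aeval_algHom_apply laurent (fourier 1) p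

theorem laurent_fourier_add (m n : ℤ) (f : LpT 2) :
    laurent (fourier (m + n)) f = laurent (fourier m) (laurent (fourier n) f) := by
  rw [← mul_apply_eq_comp, ← map_mul]
  congr 2
  ext t
  exact fourier_add

theorem laurent_fourier_zero : laurent (fourier 0) = 1 := by
  rw [← map_one laurent]
  congr 1
  ext t
  exact fourier_zero

theorem polyCircle_X_pow (n : ℕ) : polyCircle (X ^ n) = fourier n := by
  ext t
  simp [polyCircle, AddCircle.toCircle_nsmul]

theorem inner_laurent_fourier_right (n : ℤ) (f g : LpT 2) :
    inner ℂ f (laurent (fourier n) g) = fourierCoeff (fun t => conj (f t) * g t) (-n) := by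
  rw [L2.inner_def, fourierCoeff, neg_neg]
  refine integral_congr_ae ?_
  filter_upwards [coeFn_mulCont (fourier n) g] with t h
  rw [RCLike.inner_apply', h, smul_eq_mul]
  ring

theorem inner_laurent_fourier_left (n : ℤ) (f g : LpT 2) :
    inner ℂ (laurent (fourier n) f) g = inner ℂ f (laurent (fourier (-n)) g) := by
  rw [L2.inner_def, L2.inner_def]
  refine integral_congr_ae ?_
  filter_upwards [coeFn_mulCont (fourier n) f, coeFn_mulCont (fourier (-n)) g] with t hf hg
  simp only [RCLike.inner_apply', hf, hg, map_mul, fourier_neg]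
  ring

end Laurent

section Hardy

theorem isClosed_hardy_two : IsClosed (Hardy 2 : Set (LpT 2)) := by
  have : (Hardy 2 : Set (LpT 2)) = ⋂ n : ℤ, ⋂ _ : n < 0, {f | fourierBasis.repr f n = 0} := by
    ext f
    simp [Hardy, fourierBasis_repr]
  rw [this]
  refine isClosed_iInter fun n => isClosed_iInter fun _ => isClosed_eq ?_ continuous_const
  simp_rw [HilbertBasis.repr_apply_apply]
  fun_prop

theorem fourierCoeff_shift (n : ℤ) (f : LpT 2) :
    fourierCoeff (shift f : UnitAddCircle → ℂ) n = fourierCoeff f (n - 1) := by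
  rw [fourierCoeff, fourierCoeff]
  refine integral_congr_ae ?_
  filter_upwards [coeFn_mulCont (fourier 1) f] with t h
  rw [h, smul_eq_mul, smul_eq_mul, ← mul_assoc, ← fourier_add]
  congr 3
  ring

theorem shift_mem_hardy : ∀ f ∈ Hardy 2, shift f ∈ Hardy 2 := fun f hf n hn => by
  rw [fourierCoeff_shift]
  exact hf _ (by lia)

theorem coeFn_polyL2 (p : ℂ[X]) :
    (polyL2 p : UnitAddCircle → ℂ) =ᵐ[circleMeasure] polyCircle p :=
  ContinuousMap.coeFn_toLp (p := 2) (𝕜 := ℂ) circleMeasure (polyCircle p)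

theorem polyL2_mul (p q : ℂ[X]) : polyL2 (p * q) = laurent (polyCircle p) (polyL2 q) := by
  apply Lp.ext
  filter_upwards [coeFn_polyL2 (p * q), coeFn_polyL2 q, coeFn_mulCont (polyCircle p) (polyL2 q)]
    with t hpq hq h
  rw [hpq, h, hq, map_mul, ContinuousMap.mul_apply]

theorem polyL2_eq_aeval_shift (p : ℂ[X]) : polyL2 p = aeval shift p (polyL2 1) := by
  rw [aeval_shift, ← polyL2_mul, mul_one]

theorem fourierLp_eq_polyL2 (n : ℕ) : fourierLp 2 (n : ℤ) = polyL2 (X ^ n) :=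
  congrArg (ContinuousMap.toLp 2 circleMeasure ℂ) (polyCircle_X_pow n).symm

theorem polyL2_mem_hardy (p : ℂ[X]) : polyL2 p ∈ Hardy 2 := by
  rw [polyL2_eq_aeval_shift]
  refine aeval_apply_mem shift_mem_hardy p fun n hn => ?_
  rw [← pow_zero X, ← fourierLp_eq_polyL2, fourierCoeff_congr_ae (coeFn_fourierLp 2 _),
    fourierCoeff_fourier]
  exact Pi.single_eq_of_ne (by simpa using hn.ne) _

theorem hardy_two_le_of_polyL2_mem {S : Submodule ℂ (LpT 2)} (hS : IsClosed (S : Set (LpT 2)))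
    (h : ∀ p, polyL2 p ∈ S) : Hardy 2 ≤ S := by
  intro f hf
  refine hS.mem_of_tendsto (hasSum_fourier_series_L2 f)
    (Eventually.of_forall fun s => S.sum_mem fun n _ => ?_)
  rcases lt_or_ge n 0 with hn | hn
  · rw [hf n hn, zero_smul]
    exact S.zero_mem
  · lift n to ℕ using hn
    rw [fourierLp_eq_polyL2]
    exact S.smul_mem _ (h _)

theorem exists_mem_hardy_laurent_eq {p : ℂ[X]} (hp : ∀ α, p.IsRoot α → 1 < ‖α‖)
    {h : LpT 2} (hh : h ∈ Hardy 2) : ∃ g ∈ Hardy 2, laurent (polyCircle p) g = h := by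
  have : CompleteSpace (Hardy 2) := isClosed_hardy_two.completeSpace_coe
  have hnorm : ‖shift.restrict shift_mem_hardy‖ ≤ 1 :=
    ContinuousLinearMap.opNorm_le_bound _ zero_le_one fun f =>
      shift.le_of_opNorm_le ((norm_mulCont_le _).trans (fourier_norm 1).le) f
  obtain ⟨g, hg⟩ : ∃ g : Hardy 2, aeval (shift.restrict shift_mem_hardy) p g = ⟨h, hh⟩ := by
    obtain ⟨u, hu⟩ := isUnit_aeval_of_norm_le_one hnorm hp
    rw [← hu]
    exact (ContinuousLinearEquiv.ofUnit u).surjective _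
  refine ⟨g, g.2, ?_⟩
  rw [← aeval_shift, ← coe_aeval_restrict_apply shift_mem_hardy, hg]

end Hardy

section InvariantSubspaces

variable {W : Submodule ℂ (LpT 2)}

theorem laurent_fourier_mem_of_map_shift_eq (hW : W.map shift.toLinearMap = W) (n : ℤ)
    {f : LpT 2} (hf : f ∈ W) : laurent (fourier n) f ∈ W := by
  induction n with
  | zero => rwa [laurent_fourier_zero]
  | succ n ih =>
    rw [add_comm, laurent_fourier_add, ← hW]
    exact Submodule.mem_map_of_mem ih
  | pred n ih =>
    rw [← hW] at ih
    obtain ⟨g, hg, hgf⟩ := ih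
    rw [sub_eq_neg_add, laurent_fourier_add, ← hgf]
    change laurent (fourier (-1)) (laurent (fourier 1) g) ∈ W
    rwa [← laurent_fourier_add, neg_add_cancel, laurent_fourier_zero]

theorem mulLp_mem_of_map_shift_eq (hcl : IsClosed (W : Set (LpT 2)))
    (hW : W.map shift.toLinearMap = W) (a : LpT ∞) {f : LpT 2} (hf : f ∈ W) :
    mulLp circleMeasure 2 a f ∈ W := by
  have : CompleteSpace W := hcl.completeSpace_coe
  rw [← Submodule.orthogonal_orthogonal W, Submodule.mem_orthogonal]
  intro g hg
  have hgf : (fun t => conj (g t) * f t) =ᵐ[circleMeasure] 0 :=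
    ae_eq_zero_of_fourierCoeff_eq_zero (integrable_conj_mul g f) fun n => by
      rw [← neg_neg n, ← inner_laurent_fourier_right]
      exact Submodule.inner_left_of_mem_orthogonal
        (laurent_fourier_mem_of_map_shift_eq hW (-n) hf) hg
  rw [L2.inner_def]
  refine integral_eq_zero_of_ae ?_
  filter_upwards [hgf, coeFn_mulLp a f] with t h₁ h₂
  rw [RCLike.inner_apply', h₂, mul_left_comm]
  exact mul_eq_zero_of_right _ h₁

theorem norm_eq_one_of_inner_laurent_fourier_eq_zero {v : LpT 2} (hv : ‖v‖ = 1)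
    (h : ∀ n ≠ 0, inner ℂ v (laurent (fourier n) v) = 0) : ∀ᵐ t ∂circleMeasure, ‖v t‖ = 1 := by
  have hcoeff (n : ℤ) : fourierCoeff (fun t => conj (v t) * v t) n =
      fourierCoeff (fourier 0 : C(UnitAddCircle, ℂ)) n := by
    rw [fourierCoeff_fourier, ← neg_neg n, ← inner_laurent_fourier_right]
    rcases eq_or_ne n 0 with rfl | hn
    · simp [laurent_fourier_zero, hv]
    · rw [h _ (neg_ne_zero.2 hn), neg_neg, Pi.single_eq_of_ne hn]
  filter_upwards [ae_eq_of_fourierCoeff_eq (integrable_conj_mul v v)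
    ((fourier 0).continuous.integrable_of_hasCompactSupport (.of_compactSpace _)) hcoeff] with t ht
  rw [Complex.conj_mul', fourier_zero] at ht
  have hsq : ‖v t‖ ^ 2 = 1 := by exact_mod_cast ht
  exact (pow_eq_one_iff_of_nonneg (norm_nonneg _) two_ne_zero).1 hsq

theorem inner_laurent_fourier_eq_zero (hz : ∀ f ∈ W, shift f ∈ W) {v : LpT 2}
    (hv : v ∈ (W.map shift.toLinearMap)ᗮ) {n : ℤ} (hn : 0 < n) {f : LpT 2} (hf : f ∈ W) :
    inner ℂ v (laurent (fourier n) f) = 0 := by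
  obtain ⟨k, rfl⟩ : ∃ k : ℕ, n = 1 + k := ⟨(n - 1).toNat, by lia⟩
  rw [laurent_fourier_add]
  refine Submodule.inner_left_of_mem_orthogonal (Submodule.mem_map_of_mem ?_) hv
  rw [← polyCircle_X_pow, ← aeval_shift]
  exact aeval_apply_mem hz _ hf

theorem norm_eq_one_of_mem_orthogonal_map_shift (hz : ∀ f ∈ W, shift f ∈ W) {v : LpT 2}
    (hvW : v ∈ W) (hv : v ∈ (W.map shift.toLinearMap)ᗮ) (hnorm : ‖v‖ = 1) :
    ∀ᵐ t ∂circleMeasure, ‖v t‖ = 1 := by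
  refine norm_eq_one_of_inner_laurent_fourier_eq_zero hnorm fun n hn => ?_
  rcases hn.lt_or_gt with hn | hn
  · rw [← inner_conj_symm, inner_laurent_fourier_left,
      inner_laurent_fourier_eq_zero hz hv (neg_pos.2 hn) hvW, map_zero]
  · exact inner_laurent_fourier_eq_zero hz hv hn hvW

theorem exists_unimodular_eq_map_hardy (hcl : IsClosed (W : Set (LpT 2)))
    (hz : ∀ f ∈ W, shift f ∈ W) {v : LpT 2} (hvW : v ∈ W)
    (hv : v ∈ (W.map shift.toLinearMap)ᗮ) (hnorm : ‖v‖ = 1) :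
    ∃ J : LpT ∞, (∀ᵐ t ∂circleMeasure, ‖J t‖ = 1) ∧
      W = (Hardy 2).map (mulLp circleMeasure 2 J).toLinearMap := by
  have huni := norm_eq_one_of_mem_orthogonal_map_shift hz hvW hv hnorm
  have hmem : MemLp v ∞ circleMeasure :=
    memLp_top_of_bound (Lp.aestronglyMeasurable v) 1 (huni.mono fun _ => le_of_eq)
  have hJ : ∀ᵐ t ∂circleMeasure, ‖hmem.toLp v t‖ = 1 := by
    filter_upwards [hmem.coeFn_toLp, huni] with t h₁ h₂
    rw [h₁, h₂]
  refine ⟨hmem.toLp v, hJ, le_antisymm (fun f hf => ?_) ?_⟩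
  · refine ⟨mulLp circleMeasure 2 (star (hmem.toLp v)) f, fun n hn => ?_, ?_⟩
    · rw [← inner_laurent_fourier_eq_zero hz hv (neg_pos.2 hn) hf, inner_laurent_fourier_right,
        neg_neg]
      refine congrFun (fourierCoeff_congr_ae ?_) n
      filter_upwards [coeFn_mulLp (star (hmem.toLp v)) f, Lp.coeFn_star (hmem.toLp v),
        hmem.coeFn_toLp] with t h₁ h₂ h₃
      rw [h₁, h₂, Pi.star_apply, h₃, RCLike.star_def]
    · exact (mulLp_comm _ _ _).trans (mulLp_star_mulLp hJ f)
  · rw [Submodule.map_le_iff_le_comap]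
    refine hardy_two_le_of_polyL2_mem
      (hcl.preimage (mulLp circleMeasure 2 (hmem.toLp v)).continuous) fun p => ?_
    have hp : mulLp circleMeasure 2 (hmem.toLp v) (polyL2 p) = aeval shift p v := by
      rw [aeval_shift]
      apply Lp.ext
      filter_upwards [coeFn_mulLp (hmem.toLp v) (polyL2 p), hmem.coeFn_toLp, coeFn_polyL2 p,
        coeFn_mulCont (polyCircle p) v] with t h₁ h₂ h₃ h₄
      rw [h₁, h₂, h₃, h₄, mul_comm]
    rw [Submodule.mem_comap, ContinuousLinearMap.coe_coe, hp]
    exact aeval_apply_mem hz p hvW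

theorem helson_lowdenslager (hcl : IsClosed (W : Set (LpT 2))) (hz : ∀ f ∈ W, shift f ∈ W) :
    (∀ a : LpT ∞, ∀ f ∈ W, mulLp circleMeasure 2 a f ∈ W) ∨
      ∃ J : LpT ∞, (∀ᵐ t ∂circleMeasure, ‖J t‖ = 1) ∧
        W = (Hardy 2).map (mulLp circleMeasure 2 J).toLinearMap := by
  have hle : W.map shift.toLinearMap ≤ W := Submodule.map_le_iff_le_comap.2 hz
  rcases hle.eq_or_lt with heq | hlt
  · exact .inl fun a f hf => mulLp_mem_of_map_shift_eq hcl heq a hf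
  · have hunit : IsUnit shift := isUnit_mulCont fun t => by simp [fourier_apply]
    have : CompleteSpace (W.map shift.toLinearMap) :=
      (isClosed_map_of_isUnit hunit hcl).completeSpace_coe
    obtain ⟨v, hvW, hv, hv0⟩ := exists_mem_orthogonal_ne_zero_of_lt hlt
    exact .inr (exists_unimodular_eq_map_hardy hcl hz (W.smul_mem (‖v‖⁻¹ : ℂ) hvW)
      (Submodule.smul_mem _ _ hv) (by simp [norm_smul, hv0]))

end InvariantSubspaces

section Polynomials

theorem polyCircle_apply (p : ℂ[X]) (t : UnitAddCircle) :
    polyCircle p t = p.eval (fourier 1 t) := by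
  rw [← coe_aeval_eq_eval]
  exact (aeval_algHom_apply (ContinuousMap.evalAlgHom ℂ ℂ t) (fourier 1) p).symm

instance nullSingletonClass_haarAddCircle {T : ℝ} [hT : Fact (0 < T)] :
    NullSingletonClass (AddCircle.haarAddCircle (T := T)) := by
  have : Infinite (Set.Ico (0 : ℝ) (0 + T)) :=
    (Set.Ico_infinite ((zero_add T).symm ▸ hT.out)).to_subtype
  have : Nontrivial (AddCircle T) := (AddCircle.equivIco T 0).nontrivial
  infer_instance

theorem ae_polyCircle_ne_zero {p : ℂ[X]} (hp : p ≠ 0) :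
    ∀ᵐ t ∂circleMeasure, polyCircle p t ≠ 0 := by
  have hinj : Injective (fourier 1 : C(UnitAddCircle, ℂ)) := fun s t hst =>
    AddCircle.injective_toCircle one_ne_zero (Subtype.ext (by simpa using hst))
  have hfin : {t | polyCircle p t = 0}.Finite :=
    (p.roots.toFinset.finite_toSet.preimage hinj.injOn).subset fun t ht => by
      simpa [hp, polyCircle_apply] using ht
  exact hfin.countable.ae_notMem circleMeasure

theorem ae_polyLinfty_ne_zero {p : ℂ[X]} (hp : p ≠ 0) :
    ∀ᵐ t ∂circleMeasure, polyLinfty p t ≠ 0 := by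
  filter_upwards [ae_polyCircle_ne_zero hp,
    ContinuousMap.coeFn_toLp (p := ∞) (𝕜 := ℂ) circleMeasure (polyCircle p)] with t ht h
  rwa [polyLinfty, h]

end Polynomials

section Conductor

variable {A : Subalgebra ℂ ℂ[X]}

theorem laurent_mem_conductorSpace {f : ℂ[X]} (hf : f ∈ conductorIdeal A) {h : LpT 2}
    (hh : h ∈ Hardy 2) : laurent (polyCircle f) h ∈ conductorSpace A :=
  Submodule.le_topologicalClosure _ (Submodule.subset_span ⟨f, hf, h, hh, rfl⟩)

theorem polyL2_mem_conductorSpace {p : ℂ[X]} (hp : p ∈ conductorIdeal A) :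
    polyL2 p ∈ conductorSpace A := by
  rw [← mul_one p, polyL2_mul]
  exact laurent_mem_conductorSpace hp (polyL2_mem_hardy 1)

theorem conductorSpace_le {S : Submodule ℂ (LpT 2)} (hS : IsClosed (S : Set (LpT 2)))
    (h : ∀ f ∈ conductorIdeal A, ∀ g ∈ Hardy 2, laurent (polyCircle f) g ∈ S) :
    conductorSpace A ≤ S := by
  refine Submodule.topologicalClosure_minimal _ (Submodule.span_le.2 ?_) hS
  rintro _ ⟨f, hf, g, hg, rfl⟩
  exact h f hf g hg

theorem conductorSpace_eq_map {q : ℂ[X]} (hq : conductorIdeal A = Ideal.span {q})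
    (hroots : ∀ α, q.IsRoot α → ‖α‖ < 1) :
    conductorSpace A = (Hardy 2).map (laurent (polyCircle q)).toLinearMap := by
  have hunit : IsUnit (laurent (polyCircle q)) := isUnit_mulCont fun t ht =>
    (hroots (fourier 1 t) (by rwa [polyCircle_apply] at ht)).ne <| by
      rw [fourier_apply, Circle.norm_coe]
  refine le_antisymm (conductorSpace_le (isClosed_map_of_isUnit hunit isClosed_hardy_two) ?_) ?_
  · intro f hf g hg
    obtain ⟨r, rfl⟩ := Ideal.mem_span_singleton.1 (hq ▸ hf)
    rw [map_mul, map_mul, mul_apply_eq_comp, ← aeval_shift r]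
    exact Submodule.mem_map_of_mem (aeval_apply_mem shift_mem_hardy r hg)
  · rintro _ ⟨g, hg, rfl⟩
    exact laurent_mem_conductorSpace (hq ▸ Ideal.mem_span_singleton_self q) hg

theorem exists_polyL2_add_of_mem_hardy (hA : conductorIdeal A ≠ ⊥) {f : LpT 2}
    (hf : f ∈ Hardy 2) : ∃ p : ℂ[X], ∃ c ∈ conductorSpace A, polyL2 p + c = f := by
  obtain ⟨q, hq, hq0⟩ := Submodule.exists_mem_ne_zero_of_ne_bot hA
  let V : Submodule ℂ (LpT 2) := (degreeLT ℂ q.natDegree).map polyL2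
  have : FiniteDimensional ℂ (degreeLT ℂ q.natDegree) :=
    (degreeLTEquiv ℂ _).symm.finiteDimensional
  have hclosed : IsClosed ((conductorSpace A ⊔ V : Submodule ℂ (LpT 2)) : Set (LpT 2)) :=
    Submodule.isClosed_sup_finiteDimensional _ _ (Submodule.isClosed_topologicalClosure _)
  have hle : Hardy 2 ≤ conductorSpace A ⊔ V := hardy_two_le_of_polyL2_mem hclosed fun p => by
    rw [← EuclideanDomain.div_add_mod p q, map_add]
    refine Submodule.add_mem_sup
      (polyL2_mem_conductorSpace (Ideal.mul_mem_right _ _ hq)) ⟨_, ?_, rfl⟩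
    rw [SetLike.mem_coe, mem_degreeLT, ← degree_eq_natDegree hq0]
    exact degree_mod_lt _ hq0
  obtain ⟨c, hc, _, ⟨p, -, rfl⟩, rfl⟩ := Submodule.mem_sup.1 (hle hf)
  exact ⟨p, c, hc, add_comm _ _⟩

theorem H2sub_eq_map_sup (M : Submodule (quotAlg A) (ℂ[X] ⧸ conductorIdeal A)) :
    H2sub A M = ((M.restrictScalars ℂ).comap
      (Ideal.Quotient.mkₐ ℂ (conductorIdeal A)).toLinearMap).map polyL2 ⊔ conductorSpace A := by
  have : CompleteSpace (conductorSpace A) :=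
    (Submodule.isClosed_topologicalClosure _).completeSpace_coe
  rw [H2sub, complementPart, Submodule.map_comp, map_starProjection_orthogonal_sup]

/-- The `A / 𝔠`-submodule of `ℂ[z] / 𝔠` formed by the classes of the polynomials that lie in an
`A`-invariant subspace `N` of `L²(𝕋)`. -/
noncomputable def polyClasses (A : Subalgebra ℂ ℂ[X]) (N : Submodule ℂ (LpT 2))
    (hN : ∀ p ∈ A, ∀ f ∈ N, laurent (polyCircle p) f ∈ N) :
    Submodule (quotAlg A) (ℂ[X] ⧸ conductorIdeal A) where
  __ := ((N.comap polyL2).map (Ideal.Quotient.mkₐ ℂ (conductorIdeal A)).toLinearMap).toAddSubmonoid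
  smul_mem' := by
    rintro ⟨_, b, hb, rfl⟩ _ ⟨p, hp, rfl⟩
    refine ⟨b * p, ?_, map_mul (Ideal.Quotient.mkₐ ℂ (conductorIdeal A)) b p⟩
    rw [SetLike.mem_coe, Submodule.mem_comap, polyL2_mul]
    exact hN b hb _ hp

theorem mk_mem_polyClasses_iff {N : Submodule ℂ (LpT 2)}
    {hN : ∀ p ∈ A, ∀ f ∈ N, laurent (polyCircle p) f ∈ N} (hCN : conductorSpace A ≤ N)
    {p : ℂ[X]} : Ideal.Quotient.mkₐ ℂ (conductorIdeal A) p ∈ polyClasses A N hN ↔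
      polyL2 p ∈ N := by
  refine ⟨?_, fun h => ⟨p, h, rfl⟩⟩
  rintro ⟨r, hr, hrp⟩
  have hmem : p - r ∈ conductorIdeal A := Ideal.Quotient.eq.1 hrp.symm
  rw [← sub_add_cancel p r, map_add]
  exact N.add_mem (hCN (polyL2_mem_conductorSpace hmem)) hr

theorem eq_H2sub_polyClasses (hA : conductorIdeal A ≠ ⊥) {N : Submodule ℂ (LpT 2)}
    (hCN : conductorSpace A ≤ N) (hNH : N ≤ Hardy 2)
    (hN : ∀ p ∈ A, ∀ f ∈ N, laurent (polyCircle p) f ∈ N) : N = H2sub A (polyClasses A N hN) := by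
  rw [H2sub_eq_map_sup]
  refine le_antisymm (fun f hf => ?_) (sup_le ?_ hCN)
  · obtain ⟨p, c, hc, rfl⟩ := exists_polyL2_add_of_mem_hardy hA (hNH hf)
    have hp : polyL2 p ∈ N := (N.add_mem_iff_left (hCN hc)).1 hf
    exact Submodule.add_mem_sup
      (Submodule.mem_map_of_mem ((mk_mem_polyClasses_iff (hN := hN) hCN).2 hp)) hc
  · rintro _ ⟨p, hp, rfl⟩
    exact (mk_mem_polyClasses_iff (hN := hN) hCN).1 hp

theorem exists_eq_map_H2sub (hA : conductorIdeal A ≠ ⊥) {J : LpT ∞}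
    (hJ : ∀ᵐ t ∂circleMeasure, ‖J t‖ = 1) {N : Submodule ℂ (LpT 2)}
    (hN_closed : IsClosed (N : Set (LpT 2)))
    (hN : ∀ p ∈ A, ∀ f ∈ N, laurent (polyCircle p) f ∈ N)
    (hNJ : N ≤ (Hardy 2).map (mulLp circleMeasure 2 J).toLinearMap)
    (hJN : ∀ q ∈ conductorIdeal A, ∀ g ∈ Hardy 2,
      laurent (polyCircle q) (mulLp circleMeasure 2 J g) ∈ N) :
    ∃ M : Submodule (quotAlg A) (ℂ[X] ⧸ conductorIdeal A),
      N = (H2sub A M).map (mulLp circleMeasure 2 J).toLinearMap := by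
  have hbij : Bijective (mulLp circleMeasure 2 J) := mulLp_bijective hJ
  let K : Submodule ℂ (LpT 2) := N.comap (mulLp circleMeasure 2 J).toLinearMap
  have hCK : conductorSpace A ≤ K :=
    conductorSpace_le (hN_closed.preimage (mulLp circleMeasure 2 J).continuous) fun q hq g hg => by
      rw [Submodule.mem_comap, ContinuousLinearMap.coe_coe, mulLp_mulCont_comm]
      exact hJN q hq g hg
  have hKH : K ≤ Hardy 2 :=
    (Submodule.comap_mono hNJ).trans_eq (Submodule.comap_map_eq_of_injective hbij.1 _)
  have hK : ∀ p ∈ A, ∀ f ∈ K, laurent (polyCircle p) f ∈ K := fun p hp f hf => by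
    rw [Submodule.mem_comap, ContinuousLinearMap.coe_coe, mulLp_mulCont_comm]
    exact hN p hp _ hf
  refine ⟨polyClasses A K hK, ?_⟩
  rw [← eq_H2sub_polyClasses hA hCK hKH hK]
  exact (Submodule.map_comap_eq_of_surjective hbij.2 N).symm

end Conductor

section Blaschke

/-- The polynomial `E = c ∏ⱼ (1 - ᾱⱼ z)` for `q = c ∏ⱼ (z - αⱼ)`, so that `q / E` is the Blaschke
product with the zeros of `q`. -/
noncomputable def blaschkeDenom (q : ℂ[X]) : ℂ[X] :=
  C q.leadingCoeff * (q.roots.map fun α => 1 - C (conj α) * X).prod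

theorem eval_blaschkeDenom (q : ℂ[X]) (z : ℂ) :
    (blaschkeDenom q).eval z = q.leadingCoeff * (q.roots.map fun α => 1 - conj α * z).prod := by
  simp [blaschkeDenom, eval_multiset_prod, Multiset.map_map]

theorem one_lt_norm_of_isRoot_blaschkeDenom {q : ℂ[X]} (hq0 : q ≠ 0)
    (hq : ∀ α, q.IsRoot α → ‖α‖ < 1) {β : ℂ} (hβ : (blaschkeDenom q).IsRoot β) : 1 < ‖β‖ := by
  rw [IsRoot, eval_blaschkeDenom, mul_eq_zero, Multiset.prod_eq_zero_iff, Multiset.mem_map] at hβ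
  obtain ⟨α, hα, hαβ⟩ := hβ.resolve_left (leadingCoeff_ne_zero.2 hq0)
  have hnorm : ‖α‖ * ‖β‖ = 1 := by
    rw [← RCLike.norm_conj α, ← norm_mul, ← sub_eq_zero.1 hαβ, norm_one]
  have hα1 := hq α (isRoot_of_mem_roots hα)
  nlinarith [norm_nonneg α, norm_nonneg β]

theorem polyCircle_eq_prod_mul_blaschkeDenom {q : ℂ[X]} (hq : ∀ α, q.IsRoot α → ‖α‖ < 1)
    (t : UnitAddCircle) : polyCircle q t =
      (q.roots.map fun α => (fourier 1 t - α) / (1 - conj α * fourier 1 t)).prod *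
        polyCircle (blaschkeDenom q) t := by
  have hne : ∀ α ∈ q.roots, 1 - conj α * fourier 1 t ≠ 0 := fun α hα h => by
    have hnorm := congrArg norm (sub_eq_zero.1 h)
    rw [norm_one, norm_mul, RCLike.norm_conj, fourier_apply, Circle.norm_coe, mul_one] at hnorm
    exact (hq α (isRoot_of_mem_roots hα)).ne' hnorm
  rw [polyCircle_apply, polyCircle_apply, eval_blaschkeDenom, mul_left_comm,
    ← Multiset.prod_map_mul, Multiset.map_congr rfl fun α hα => div_mul_cancel₀ _ (hne α hα)]
  conv_lhs => rw [(IsAlgClosed.splits q).eq_prod_roots]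
  simp [eval_multiset_prod, Multiset.map_map]

variable {A : Subalgebra ℂ ℂ[X]}

theorem conductorIdeal_ne_bot (hA : ∀ α : ℂ, (∀ f ∈ conductorIdeal A, f.eval α = 0) → ‖α‖ < 1) :
    conductorIdeal A ≠ ⊥ := fun h => by
  simpa using hA 1 (by simp [h])

theorem mem_conductorSpace_iff_exists_blaschke_mul
    (hA : ∀ α : ℂ, (∀ f ∈ conductorIdeal A, f.eval α = 0) → ‖α‖ < 1) (u : LpT 2) :
    u ∈ conductorSpace A ↔
      ∃ h ∈ Hardy 2, (u : UnitAddCircle → ℂ) =ᵐ[circleMeasure] fun t => blaschke A t * h t := by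
  set q := Submodule.IsPrincipal.generator (conductorIdeal A)
  have hq : conductorIdeal A = Ideal.span {q} := (Ideal.span_singleton_generator _).symm
  have hq0 : q ≠ 0 := fun h => conductorIdeal_ne_bot hA (by rw [hq, h, Ideal.span_singleton_zero])
  have hroots : ∀ α, q.IsRoot α → ‖α‖ < 1 := fun α hα => hA α fun f hf => by
    rw [hq] at hf
    exact eval_eq_zero_of_dvd_of_eval_eq_zero (Ideal.mem_span_singleton.1 hf) hα
  have hfactor (t : UnitAddCircle) :
      polyCircle q t = blaschke A t * polyCircle (blaschkeDenom q) t :=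
    polyCircle_eq_prod_mul_blaschkeDenom hroots t
  rw [conductorSpace_eq_map hq hroots]
  constructor
  · rintro ⟨g, hg, rfl⟩
    refine ⟨laurent (polyCircle (blaschkeDenom q)) g, ?_, ?_⟩
    · rw [← aeval_shift]
      exact aeval_apply_mem shift_mem_hardy _ hg
    · filter_upwards [coeFn_mulCont (polyCircle q) g,
        coeFn_mulCont (polyCircle (blaschkeDenom q)) g] with t h₁ h₂
      exact h₁.trans (by rw [h₂, hfactor, mul_assoc])
  · rintro ⟨h, hh, hu⟩
    obtain ⟨g, hg, rfl⟩ := exists_mem_hardy_laurent_eq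
      (fun β => one_lt_norm_of_isRoot_blaschkeDenom hq0 hroots) hh
    refine ⟨g, hg, Lp.ext ?_⟩
    filter_upwards [hu, coeFn_mulCont (polyCircle q) g,
      coeFn_mulCont (polyCircle (blaschkeDenom q)) g] with t h₀ h₁ h₂
    exact h₁.trans (by rw [h₀, h₂, hfactor, mul_assoc])

end Blaschke

section ShiftHull

/-- The closed subspace of `L²(𝕋)` generated by the products `p f`, `p ∈ ℂ[z]`, `f ∈ N`: the
smallest closed shift-invariant subspace containing `N`. -/
noncomputable def shiftHull (N : Submodule ℂ (LpT 2)) : Submodule ℂ (LpT 2) :=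
  (⨆ p : ℂ[X], N.map (laurent (polyCircle p)).toLinearMap).topologicalClosure

variable {N : Submodule ℂ (LpT 2)}

theorem isClosed_shiftHull : IsClosed (shiftHull N : Set (LpT 2)) :=
  Submodule.isClosed_topologicalClosure _

theorem laurent_polyCircle_mem_shiftHull (p : ℂ[X]) {f : LpT 2} (hf : f ∈ N) :
    laurent (polyCircle p) f ∈ shiftHull N :=
  Submodule.le_topologicalClosure _ (Submodule.mem_iSup_of_mem p (Submodule.mem_map_of_mem hf))

theorem le_shiftHull : N ≤ shiftHull N := fun f hf => by
  simpa using laurent_polyCircle_mem_shiftHull 1 hf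

theorem laurent_polyCircle_mem_of_mem_shiftHull {S : Submodule ℂ (LpT 2)}
    (hS : IsClosed (S : Set (LpT 2))) {q : ℂ[X]}
    (h : ∀ p, ∀ f ∈ N, laurent (polyCircle (q * p)) f ∈ S) {f : LpT 2} (hf : f ∈ shiftHull N) :
    laurent (polyCircle q) f ∈ S := by
  have hle : shiftHull N ≤ S.comap (laurent (polyCircle q)).toLinearMap := by
    refine Submodule.topologicalClosure_minimal _ (iSup_le fun p => ?_)
      (hS.preimage (laurent (polyCircle q)).continuous)
    rintro _ ⟨g, hg, rfl⟩
    simpa using h p g hg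
  exact hle hf

theorem shift_mem_shiftHull : ∀ f ∈ shiftHull N, shift f ∈ shiftHull N := fun f hf => by
  rw [show shift = laurent (polyCircle X) by rw [polyCircle, aeval_X]]
  exact laurent_polyCircle_mem_of_mem_shiftHull isClosed_shiftHull
    (fun p g hg => laurent_polyCircle_mem_shiftHull (X * p) hg) hf

end ShiftHull

theorem polyLinfty_mem_weakStarClosure {A : Subalgebra ℂ ℂ[X]} {p : ℂ[X]} (hp : p ∈ A) :
    polyLinfty p ∈ weakStarClosure A :=
  @subset_closure _ weakStar _ _ ⟨p, hp, rfl⟩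

end HelsonLowdenslager

theorem theorem3_general (A : Subalgebra ℂ ℂ[X]) (hA : conductorIdeal A ≠ ⊥)
    (N : Submodule ℂ (LpT 2)) (hN_closed : IsClosed (N : Set (LpT 2)))
    (hN_inv : ∀ p ∈ A, ∀ f ∈ N, mulL2 (polyLinfty p) f ∈ N)
    (hN_not : ¬ ∀ a : LpT ∞, ∀ f ∈ N, mulL2 a f ∈ N) :
    ∃ (M : Submodule (quotAlg A) (ℂ[X] ⧸ conductorIdeal A)) (J : LpT ∞),
      (∀ᵐ t ∂circleMeasure, ‖J t‖ = 1) ∧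
      (N : Set (LpT 2)) = mulL2 J '' (H2sub A M : Set (LpT 2)) := by
  have hWN : ∀ q ∈ conductorIdeal A, ∀ f ∈ shiftHull N, laurent (polyCircle q) f ∈ N :=
    fun q hq f => laurent_polyCircle_mem_of_mem_shiftHull hN_closed fun p => hN_inv _ (hq.2 p)
  rcases helson_lowdenslager isClosed_shiftHull (shift_mem_shiftHull (N := N)) with
    hW | ⟨J, hJ, hW⟩
  · obtain ⟨q, hq, hq0⟩ := Submodule.exists_mem_ne_zero_of_ne_bot hA
    have hNW : N = shiftHull N :=
      eq_of_mulLp_mem hN_closed le_shiftHull hW (ae_polyLinfty_ne_zero hq0) (hWN q hq)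
    exact absurd (hNW ▸ hW) hN_not
  · obtain ⟨M, hM⟩ := exists_eq_map_H2sub hA hJ hN_closed hN_inv (hW ▸ le_shiftHull)
      fun q hq g hg => hWN q hq _ (hW ▸ Submodule.mem_map_of_mem hg)
    exact ⟨M, J, hJ, congrArg SetLike.coe hM⟩

theorem theorem3 (A : Subalgebra ℂ ℂ[X])
    (hA : ∀ α : ℂ, (∀ f ∈ conductorIdeal A, f.eval α = 0) → ‖α‖ < 1)
    (N : Submodule ℂ (LpT 2)) (hN_closed : IsClosed (N : Set (LpT 2)))
    (hN_inv : ∀ a ∈ weakStarClosure A, ∀ f ∈ N, mulL2 a f ∈ N)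
    (hN_not : ¬ ∀ h ∈ Hardy ∞, ∀ f ∈ N, mulL2 h f ∈ N) :
    (∀ u : LpT 2, u ∈ conductorSpace A ↔
      ∃ h ∈ Hardy 2, (u : UnitAddCircle → ℂ) =ᵐ[circleMeasure] fun t => blaschke A t * h t) ∧
    ∃ (M : Submodule (quotAlg A) (ℂ[X] ⧸ conductorIdeal A)) (J : LpT ∞),
      (∀ᵐ t ∂circleMeasure, ‖J t‖ = 1) ∧
      (N : Set (LpT 2)) = mulL2 J '' (H2sub A M : Set (LpT 2)) :=
  ⟨mem_conductorSpace_iff_exists_blaschke_mul hA,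
    theorem3_general A (conductorIdeal_ne_bot hA) N hN_closed
      (fun _ hp => hN_inv _ (polyLinfty_mem_weakStarClosure hp)) (mt (fun h a _ => h a) hN_not)⟩
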